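/- **Lemma (Oracle property of the Adaptive Lasso with different sample sizes).** Fix $p$, $\beta^*\in\mathbb R^p$, $\sigma\ge 0$ and $\gamma>0$, and let $S=\{j:\beta^*_j\neq 0\}$. For each $n$ let $X=X_n\in\mathbb R^{n\times p}$ be a deterministic design with rows $x_1^\top,\dots,x_n^\top$, and let $y=X\beta^*+\varepsilon$, where $\varepsilon_1,\dots,\varepsilon_n$ are i.i.d. $\mathcal N(0,\sigma^2)$. Assume that, as $n\to\infty$, $$\tfrac1n X^\top X\to C,\quad C \text{ positive definite},\qquad \tfrac1n\max_i\|x_i\|_2^2\to 0 .$$ Let $m=m_n$ be a sequence of nonnegative integers, and let $\tilde\beta=\tilde\beta_n$ be random vectors in $\mathbb R^p$ (the initial estimator) that are $\sqrt m$-consistent, i.e. $\sqrt{m}\,(\tilde\beta-\beta^*)=O_P(1)$ as $n\to\infty$. Let $\lambda_n\ge 0$ and let $\hat\beta_n$ be the Adaptive Lasso estimator, that is, a random vector which is almost surely a minimizer over $\beta\in\mathbb R^p$ of $$\frac1n\|y-X\beta\|_2^2+\frac{\lambda_n}{n}\sum_{j=1}^p w_j|\beta_j|,\qquad w_j=\frac1{|\tilde\beta_j|^{\gamma}},$$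 with the conventions $w_j=\infty$ if $\tilde\beta_j=0$, and $\infty\cdot 0=0$. Put $\hat S_n=\{j:\hat\beta_{n,j}\neq0\}$. If $\lambda_n/\sqrt n\to0$ and $\lambda_n\sqrt{m^{\gamma}/n}\to\infty$, then $\hat\beta_n$ has the oracle property: 1. (consistent variable selection) $\displaystyle\lim_{n\to\infty}P(\hat S_n=S)=1$; 2. ($\sqrt n$-consistency) $\sqrt n\,(\hat\beta_n-\beta^*)=O_P(1)$; 3. (asymptotic normality) $\sqrt n\,(\hat\beta_{n,S}-\beta^*_S)\xrightarrow{d}\mathcal N(0,\sigma^2C_{SS}^{-1})$. -/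

import Mathlib

open MeasureTheory ProbabilityTheory Filter Topology Matrix
open scoped NNReal ENNReal

/-- The active set `{j : βⱼ ≠ 0}` of a parameter vector. -/
noncomputable def activeSet {p : ℕ} (β : EuclideanSpace ℝ (Fin p)) : Finset (Fin p) :=
  Finset.univ.filter fun j => β j ≠ 0

/-- The subvector `β_S`. -/
noncomputable def subvector {p : ℕ} (S : Finset (Fin p)) (β : EuclideanSpace ℝ (Fin p)) :
    EuclideanSpace ℝ S :=
  WithLp.toLp 2 fun j => β j

/-- The Adaptive Lasso weight `1 / |b|^γ` of a coordinate with initial estimate `b`.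
For `γ > 0` it equals `∞` when `b = 0`. -/
noncomputable def adaptiveWeight (γ b : ℝ) : ℝ≥0∞ :=
  (ENNReal.ofReal (|b| ^ γ))⁻¹

/-- The Adaptive Lasso objective
`(1/n) ‖y - X β‖² + (lam/n) ∑ⱼ wⱼ |βⱼ|` with `wⱼ = 1 / |βinitⱼ|^γ`, for `lam ≥ 0`.
It takes values in `[0, ∞]` with `∞ * 0 = 0`: for `lam > 0`, a coordinate whose initial
estimate is `0` costs `∞` unless it is `0`. -/
noncomputable def adaptiveLassoObjective {n p : ℕ} (X : Matrix (Fin n) (Fin p) ℝ)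
    (y : Fin n → ℝ) (lam γ : ℝ) (βinit β : EuclideanSpace ℝ (Fin p)) : ℝ≥0∞ :=
  ENNReal.ofReal ((1 / n) * ∑ i, (y i - (X *ᵥ β.ofLp) i) ^ 2) +
    ENNReal.ofReal (lam / n) * ∑ j, adaptiveWeight γ (βinit j) * ENNReal.ofReal |β j|

/-- `b` is a minimizer of the Adaptive Lasso objective. -/
def IsAdaptiveLasso {n p : ℕ} (X : Matrix (Fin n) (Fin p) ℝ) (y : Fin n → ℝ) (lam γ : ℝ)
    (βinit b : EuclideanSpace ℝ (Fin p)) : Prop :=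
  ∀ β, adaptiveLassoObjective X y lam γ βinit b ≤ adaptiveLassoObjective X y lam γ βinit β

/-- The estimators `T n` of `θ` are `√(r n)`-consistent: `√(r n) (T n - θ) = O_P(1)`. -/
def IsRootConsistent {Ω E : Type*} [MeasurableSpace Ω] [NormedAddCommGroup E]
    (P : Measure Ω) (r : ℕ → ℕ) (T : ℕ → Ω → E) (θ : E) : Prop :=
  ∀ δ : ℝ, 0 < δ → ∃ M : ℝ, ∀ᶠ n in atTop,
    P {ω | M < √(r n : ℝ) * ‖T n ω - θ‖} ≤ ENNReal.ofReal δ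

/-! Write `u = √n (b - β*)`, `G = XᵀX / n` and `W = Xᵀε / √n`. The optimality conditions of the
Adaptive Lasso read `2 |W - G u|ⱼ ≤ lam wⱼ / √n`, with equality where `bⱼ ≠ 0`. Up to an event of
small probability `W` and `√m (βinit - β*)` are bounded, and then everything is deterministic. On
the active set `wⱼ` is bounded and `lam / √n → 0`, so the penalty is negligible and `u` is bounded
by coercivity of `G`. Off the active set `|βinitⱼ| ≤ M / √m` makes `lam wⱼ / √n` at least of order
`lam √(m ^ γ / n) → ∞`, which contradicts equality, so `bⱼ = 0`. What remains is
`C_SS u_S = W_S + o(1)`, and `W` is exactly `N(0, σ² G)` with `G → C`. -/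

section WeightedLasso

variable {κ ι : Type*} [Fintype κ] [Fintype ι] {X : Matrix κ ι ℝ} {y : κ → ℝ} {w : ι → ℝ}

/-- The residual sum of squares of `β` plus the `ℓ¹` penalty with weights `w`. -/
def weightedLassoObjective (X : Matrix κ ι ℝ) (y : κ → ℝ) (w β : ι → ℝ) : ℝ :=
  ∑ i, (y i - (X *ᵥ β) i) ^ 2 + ∑ j, w j * |β j|

/-- `b` minimizes the weighted lasso objective among the vectors supported in `A`. The complement
of `A` plays the part of the coordinates with infinite weight. -/
structure IsWeightedLasso (X : Matrix κ ι ℝ) (y : κ → ℝ) (A : Set ι) (w b : ι → ℝ) : Prop where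
  eq_zero : ∀ j ∉ A, b j = 0
  objective_le : ∀ β : ι → ℝ, (∀ j ∉ A, β j = 0) →
    weightedLassoObjective X y w b ≤ weightedLassoObjective X y w β

lemma sum_sub_mulVec_add_sq (X : Matrix κ ι ℝ) (y : κ → ℝ) (b s : ι → ℝ) :
    ∑ i, (y i - (X *ᵥ (b + s)) i) ^ 2 =
      ∑ i, (y i - (X *ᵥ b) i) ^ 2 - 2 * (s ⬝ᵥ Xᵀ *ᵥ (y - X *ᵥ b)) + (X *ᵥ s) ⬝ᵥ (X *ᵥ s) := by
  rw [dotProduct_mulVec, vecMul_transpose, mulVec_add]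
  simp only [dotProduct, Finset.mul_sum, ← Finset.sum_sub_distrib, ← Finset.sum_add_distrib]
  refine Finset.sum_congr rfl fun i _ ↦ ?_
  simp only [Pi.add_apply, Pi.sub_apply]
  ring

lemma weightedLassoObjective_add (X : Matrix κ ι ℝ) (y : κ → ℝ) (w b s : ι → ℝ) :
    weightedLassoObjective X y w (b + s) = weightedLassoObjective X y w b -
      2 * (s ⬝ᵥ Xᵀ *ᵥ (y - X *ᵥ b)) + (X *ᵥ s) ⬝ᵥ (X *ᵥ s) +
      ∑ j, w j * (|b j + s j| - |b j|) := by
  simp only [weightedLassoObjective, sum_sub_mulVec_add_sq, mul_sub, Finset.sum_sub_distrib,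
    Pi.add_apply]
  ring

lemma two_mul_abs_le_of_forall_quadratic {g a L : ℝ}
    (h : ∀ t : ℝ, 2 * t * g ≤ t ^ 2 * a + |t| * L) : 2 * |g| ≤ L := by
  have hpos (t : ℝ) (ht : 0 < t) : 2 * |g| ≤ t * a + L := by
    have hright := h t
    have hleft := h (-t)
    rw [abs_neg, abs_of_pos ht] at hleft
    rw [abs_of_pos ht] at hright
    refine le_of_mul_le_mul_left ?_ ht
    rcases abs_cases g with ⟨hg, _⟩ | ⟨hg, _⟩ <;> rw [hg] <;> linarith
  have hlim : Tendsto (fun t : ℝ ↦ t * a + L) (𝓝[>] 0) (𝓝 L) :=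
    ((continuous_mul_const a |>.add_const L).tendsto' 0 L (by simp)).mono_left inf_le_left
  exact ge_of_tendsto hlim (eventually_mem_nhdsWithin.mono hpos)

namespace IsWeightedLasso

variable {A : Set ι} {b : ι → ℝ}

lemma dotProduct_mulVec_le (h : IsWeightedLasso X y A w b) {β : ι → ℝ}
    (hβ : ∀ j ∉ A, β j = 0) :
    (X *ᵥ (b - β)) ⬝ᵥ (X *ᵥ (b - β)) ≤
      2 * ((b - β) ⬝ᵥ Xᵀ *ᵥ (y - X *ᵥ β)) + ∑ j, w j * (|β j| - |b j|) := by
  have hexpand := weightedLassoObjective_add X y w β (b - β)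
  have hpenalty : ∑ j, w j * (|β j| - |b j|) = -∑ j, w j * (|β j + (b - β) j| - |β j|) := by
    simp [← Finset.sum_neg_distrib, ← mul_neg]
  rw [add_sub_cancel] at hexpand
  linarith [h.objective_le β hβ]

lemma two_mul_mul_residualScore_le (h : IsWeightedLasso X y A w b) {j : ι}
    (hj : j ∈ A) (t : ℝ) :
    2 * t * (Xᵀ *ᵥ (y - X *ᵥ b)) j ≤
      t ^ 2 * (X.col j ⬝ᵥ X.col j) + w j * (|b j + t| - |b j|) := by
  classical
  have hle := h.objective_le (b + Pi.single j t) fun k hk ↦ by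
    rw [Pi.add_apply, h.eq_zero k hk, Pi.single_eq_of_ne (ne_of_mem_of_not_mem hj hk).symm,
      add_zero]
  have hpenalty : ∑ k, w k * (|b k + (Pi.single j t : ι → ℝ) k| - |b k|) =
      w j * (|b j + t| - |b j|) := by
    rw [Finset.sum_eq_single j (fun k _ hk ↦ by simp [Pi.single_eq_of_ne hk]) (by simp),
      Pi.single_eq_same]
  have hcol : X *ᵥ Pi.single j t = t • X.col j := by
    rw [mulVec_single, op_smul_eq_smul]
  rw [weightedLassoObjective_add, hpenalty, hcol, single_dotProduct, smul_dotProduct,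
    dotProduct_smul, smul_eq_mul, smul_eq_mul] at hle
  linarith

lemma two_mul_abs_residualScore_le (h : IsWeightedLasso X y A w b) {j : ι} (hj : j ∈ A)
    (hw : 0 ≤ w j) : 2 * |(Xᵀ *ᵥ (y - X *ᵥ b)) j| ≤ w j := by
  refine two_mul_abs_le_of_forall_quadratic (a := X.col j ⬝ᵥ X.col j) fun t ↦ ?_
  have habs : |b j + t| - |b j| ≤ |t| := by linarith [abs_add_le (b j) t]
  linarith [h.two_mul_mul_residualScore_le hj t, mul_le_mul_of_nonneg_left habs hw]

lemma two_mul_residualScore_eq (h : IsWeightedLasso X y A w b) {j : ι} (hb : b j ≠ 0) :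
    2 * (Xᵀ *ᵥ (y - X *ᵥ b)) j = w j * SignType.sign (b j) := by
  have hj : j ∈ A := by_contra fun hj ↦ hb (h.eq_zero j hj)
  set g := (Xᵀ *ᵥ (y - X *ᵥ b)) j
  set a := X.col j ⬝ᵥ X.col j
  have hmin : IsLocalMin (fun t ↦ t ^ 2 * a + w j * (|b j + t| - |b j|) - 2 * t * g) 0 :=
    Eventually.of_forall fun t ↦ by
      simpa using h.two_mul_mul_residualScore_le hj t
  have habs : HasDerivAt (fun t ↦ |b j + t|) (SignType.sign (b j) : ℝ) 0 := by
    simpa using HasDerivAt.comp_const_add (b j) 0 (hasDerivAt_abs (x := b j + 0) (by simpa))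
  have hderiv := (((hasDerivAt_pow 2 (0 : ℝ)).mul_const a).add
    ((habs.sub_const |b j|).const_mul (w j))).sub
    (((hasDerivAt_id (0 : ℝ)).const_mul 2).mul_const g)
  have hstationary : w j * SignType.sign (b j) - 2 * g = 0 := by
    simpa using hmin.hasDerivAt_eq_zero hderiv
  linarith

lemma weight_le_two_mul_abs_residualScore (h : IsWeightedLasso X y A w b) {j : ι}
    (hb : b j ≠ 0) : w j ≤ 2 * |(Xᵀ *ᵥ (y - X *ᵥ b)) j| := by
  have hsign : |(SignType.sign (b j) : ℝ)| = 1 := by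
    rcases hb.lt_or_gt with hb | hb <;> simp [sign_neg, sign_pos, hb]
  calc w j ≤ |w j * SignType.sign (b j)| := by
        rw [abs_mul, hsign, mul_one]; exact le_abs_self _
    _ = 2 * |(Xᵀ *ᵥ (y - X *ᵥ b)) j| := by
        rw [← h.two_mul_residualScore_eq hb, abs_mul, abs_two]

end IsWeightedLasso

end WeightedLasso

section AdaptiveLasso

variable {n p : ℕ} {X : Matrix (Fin n) (Fin p) ℝ} {y : Fin n → ℝ} {lam γ : ℝ}
  {βinit b β : EuclideanSpace ℝ (Fin p)}

lemma adaptiveWeight_zero (hγ : 0 < γ) : adaptiveWeight γ 0 = ∞ := by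
  simp [adaptiveWeight, Real.zero_rpow hγ.ne']

lemma adaptiveWeight_of_ne_zero (γ : ℝ) {x : ℝ} (hx : x ≠ 0) :
    adaptiveWeight γ x = ENNReal.ofReal (|x| ^ γ)⁻¹ := by
  rw [adaptiveWeight, ENNReal.ofReal_inv_of_pos (Real.rpow_pos_of_pos (abs_pos.2 hx) γ)]

lemma adaptiveLassoObjective_eq_ofReal (X : Matrix (Fin n) (Fin p) ℝ) (y : Fin n → ℝ) (γ : ℝ)
    (hlam : 0 ≤ lam) (hβ : ∀ j, βinit j = 0 → β j = 0) :
    adaptiveLassoObjective X y lam γ βinit β =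
      ENNReal.ofReal ((1 / n) *
        weightedLassoObjective X y (fun j ↦ lam / |βinit j| ^ γ) β.ofLp) := by
  have hterm (j : Fin p) : adaptiveWeight γ (βinit j) * ENNReal.ofReal |β j| =
      ENNReal.ofReal ((|βinit j| ^ γ)⁻¹ * |β j|) := by
    by_cases hj : βinit j = 0
    · simp [hβ j hj]
    · rw [adaptiveWeight_of_ne_zero γ hj, ENNReal.ofReal_mul (by positivity)]
  have hpenalty : ∑ j, lam / |βinit j| ^ γ * |β j| =
      lam * ∑ j, (|βinit j| ^ γ)⁻¹ * |β j| := by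
    simp only [Finset.mul_sum, div_eq_mul_inv, mul_assoc]
  simp only [adaptiveLassoObjective, hterm]
  rw [← ENNReal.ofReal_sum_of_nonneg fun j _ ↦ by positivity,
    ← ENNReal.ofReal_mul (by positivity), ← ENNReal.ofReal_add (by positivity) (by positivity),
    weightedLassoObjective, hpenalty]
  congr 1
  ring

lemma eq_zero_of_adaptiveLassoObjective_ne_top (hn : 0 < n) (hlam : 0 < lam) (hγ : 0 < γ)
    (h : adaptiveLassoObjective X y lam γ βinit β ≠ ∞) {j : Fin p} (hj : βinit j = 0) :
    β j = 0 := by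
  by_contra hβ
  have hsum : ∑ k, adaptiveWeight γ (βinit k) * ENNReal.ofReal |β k| = ∞ := by
    refine ENNReal.sum_eq_top.2 ⟨j, Finset.mem_univ j, ?_⟩
    rw [hj, adaptiveWeight_zero hγ, ENNReal.top_mul (by simpa using hβ)]
  have hfactor : ENNReal.ofReal (lam / n) ≠ 0 := by
    simpa using div_pos hlam (Nat.cast_pos.2 hn)
  exact h (by rw [adaptiveLassoObjective, hsum, ENNReal.mul_top hfactor, add_top])

lemma IsAdaptiveLasso.isWeightedLasso (hn : 0 < n) (hlam : 0 < lam) (hγ : 0 < γ)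
    (h : IsAdaptiveLasso X y lam γ βinit b) :
    IsWeightedLasso X y {j | βinit j ≠ 0} (fun j ↦ lam / |βinit j| ^ γ) b.ofLp := by
  have hsupp (j : Fin p) (hj : βinit j = 0) : b j = 0 := by
    refine eq_zero_of_adaptiveLassoObjective_ne_top hn hlam hγ (X := X) (y := y) ?_ hj
    refine ne_top_of_le_ne_top ?_ (h 0)
    rw [adaptiveLassoObjective_eq_ofReal X y γ hlam.le (by simp)]
    exact ENNReal.ofReal_ne_top
  refine ⟨fun j hj ↦ hsupp j (not_not.1 hj), fun β hβ ↦ ?_⟩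
  have hle := h (WithLp.toLp 2 β)
  have hβ' (j : Fin p) (hj : βinit j = 0) : WithLp.toLp 2 β j = 0 := hβ j (by simpa using hj)
  have hnonneg : 0 ≤ weightedLassoObjective X y (fun j ↦ lam / |βinit j| ^ γ) β := by
    unfold weightedLassoObjective
    positivity
  rw [adaptiveLassoObjective_eq_ofReal X y γ hlam.le hβ',
    adaptiveLassoObjective_eq_ofReal X y γ hlam.le hsupp,
    ENNReal.ofReal_le_ofReal_iff (by positivity)] at hle
  exact le_of_mul_le_mul_left hle (by positivity)

end AdaptiveLasso

section RescaledError

variable {n : ℕ} {ι : Type*} [Fintype ι]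

/-- The normalized Gram matrix `XᵀX / n` of a design with `n` rows. -/
noncomputable def normalizedGram (X : Matrix (Fin n) ι ℝ) : Matrix ι ι ℝ :=
  (1 / (n : ℝ)) • (Xᵀ * X)

/-- The normalized score `Xᵀe / √n` of the error vector `e`. -/
noncomputable def noiseScore (X : Matrix (Fin n) ι ℝ) (e : Fin n → ℝ) : EuclideanSpace ℝ ι :=
  WithLp.toLp 2 ((√(n : ℝ))⁻¹ • Xᵀ *ᵥ e)

lemma dotProduct_normalizedGram_mulVec_sqrt_smul (hn : 0 < n) (X : Matrix (Fin n) ι ℝ)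
    (d : ι → ℝ) :
    (√(n : ℝ) • d) ⬝ᵥ normalizedGram X *ᵥ (√(n : ℝ) • d) = (X *ᵥ d) ⬝ᵥ (X *ᵥ d) := by
  rw [normalizedGram, smul_mulVec, ← mulVec_mulVec, dotProduct_smul, dotProduct_mulVec,
    vecMul_transpose, mulVec_smul, smul_dotProduct, dotProduct_smul, smul_smul, smul_smul,
    mul_assoc, Real.mul_self_sqrt n.cast_nonneg, one_div_mul_cancel (by positivity), one_smul]

lemma transpose_mulVec_residual (hn : 0 < n) (X : Matrix (Fin n) ι ℝ) (e : Fin n → ℝ)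
    (β b : EuclideanSpace ℝ ι) :
    Xᵀ *ᵥ (X *ᵥ β.ofLp + e - X *ᵥ b.ofLp) = √(n : ℝ) •
      ((noiseScore X e).ofLp - normalizedGram X *ᵥ (√(n : ℝ) • (b - β)).ofLp) := by
  have hresidual : X *ᵥ β.ofLp + e - X *ᵥ b.ofLp = e - X *ᵥ (b - β).ofLp := by
    rw [WithLp.ofLp_sub, mulVec_sub]; abel
  have hscale : √(n : ℝ) * √(n : ℝ) * (1 / n) = 1 := by
    rw [Real.mul_self_sqrt n.cast_nonneg, mul_one_div_cancel (by positivity)]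
  rw [hresidual, mulVec_sub, noiseScore, smul_sub, normalizedGram, WithLp.ofLp_smul, mulVec_smul,
    smul_mulVec, smul_smul, smul_smul, smul_smul, hscale, mul_inv_cancel₀ (by positivity),
    one_smul, one_smul, mulVec_mulVec]

lemma sqrt_mul_noiseScore_dotProduct (hn : 0 < n) (X : Matrix (Fin n) ι ℝ) (e : Fin n → ℝ)
    (d : ι → ℝ) : (√(n : ℝ) • d) ⬝ᵥ (noiseScore X e).ofLp = d ⬝ᵥ Xᵀ *ᵥ e := by
  rw [noiseScore, smul_dotProduct, dotProduct_smul, smul_smul, mul_inv_cancel₀ (by positivity),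
    one_smul]

namespace IsWeightedLasso

variable {X : Matrix (Fin n) ι ℝ} {e : Fin n → ℝ} {A : Set ι} {w : ι → ℝ}
  {β b : EuclideanSpace ℝ ι}

lemma rescaledError_dotProduct_le (h : IsWeightedLasso X (X *ᵥ β.ofLp + e) A w b.ofLp)
    (hn : 0 < n) (hw : ∀ j, 0 ≤ w j) (hβA : ∀ j ∉ A, β j = 0) {S : Finset ι}
    (hβS : ∀ j ∉ S, β j = 0) :
    (√(n : ℝ) • (b - β)).ofLp ⬝ᵥ normalizedGram X *ᵥ (√(n : ℝ) • (b - β)).ofLp ≤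
      2 * ((√(n : ℝ) • (b - β)).ofLp ⬝ᵥ (noiseScore X e).ofLp) +
        ∑ j ∈ S, w j / √(n : ℝ) * |(√(n : ℝ) • (b - β)) j| := by
  have hpenalty : ∑ j, w j * (|β j| - |b j|) ≤
      ∑ j ∈ S, w j / √(n : ℝ) * |(√(n : ℝ) • (b - β)) j| := by
    calc ∑ j, w j * (|β j| - |b j|) ≤ ∑ j ∈ S, w j * (|β j| - |b j|) :=
          Finset.sum_le_sum_of_subset_of_nonpos' (Finset.subset_univ S) fun j _ hj ↦ by
            simp [hβS j hj, mul_nonneg (hw j) (abs_nonneg (b j))]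
      _ ≤ ∑ j ∈ S, w j / √(n : ℝ) * |(√(n : ℝ) • (b - β)) j| := by
          refine Finset.sum_le_sum fun j _ ↦ ?_
          rw [PiLp.smul_apply, smul_eq_mul, abs_mul, abs_of_nonneg (Real.sqrt_nonneg _),
            div_mul_eq_mul_div, mul_div_assoc, mul_div_cancel_left₀ _ (by positivity)]
          exact mul_le_mul_of_nonneg_left
            ((abs_sub_abs_le_abs_sub _ _).trans_eq (abs_sub_comm _ _)) (hw j)
  have hbasic := h.dotProduct_mulVec_le hβA
  rw [add_sub_cancel_left] at hbasic
  rw [WithLp.ofLp_smul, WithLp.ofLp_sub] at hpenalty ⊢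
  rw [dotProduct_normalizedGram_mulVec_sqrt_smul hn, sqrt_mul_noiseScore_dotProduct hn]
  linarith

lemma two_mul_abs_noiseScore_sub_le (h : IsWeightedLasso X (X *ᵥ β.ofLp + e) A w b.ofLp)
    (hn : 0 < n) {j : ι} (hj : j ∈ A) (hw : 0 ≤ w j) :
    2 * |noiseScore X e j - (normalizedGram X *ᵥ (√(n : ℝ) • (b - β)).ofLp) j| ≤
      w j / √(n : ℝ) := by
  have hkkt := h.two_mul_abs_residualScore_le hj hw
  rw [transpose_mulVec_residual hn, Pi.smul_apply, smul_eq_mul, abs_mul,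
    abs_of_nonneg (Real.sqrt_nonneg _)] at hkkt
  rw [le_div_iff₀' (by positivity)]
  simp only [Pi.sub_apply] at hkkt
  linarith

lemma weight_div_sqrt_le (h : IsWeightedLasso X (X *ᵥ β.ofLp + e) A w b.ofLp)
    (hn : 0 < n) {j : ι} (hb : b j ≠ 0) :
    w j / √(n : ℝ) ≤
      2 * |noiseScore X e j - (normalizedGram X *ᵥ (√(n : ℝ) • (b - β)).ofLp) j| := by
  have hkkt := h.weight_le_two_mul_abs_residualScore hb
  rw [transpose_mulVec_residual hn, Pi.smul_apply, smul_eq_mul, abs_mul,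
    abs_of_nonneg (Real.sqrt_nonneg _)] at hkkt
  rw [div_le_iff₀' (by positivity)]
  simp only [Pi.sub_apply] at hkkt
  linarith

end IsWeightedLasso

end RescaledError

section AdaptiveWeights

variable {α : Type*} {l : Filter α} {a s : α → ℝ} {γ : ℝ}

lemma tendsto_atTop_of_tendsto_mul_rpow (hs : ∀ n, 0 ≤ s n) (hγ : 0 < γ)
    (ha : Tendsto a l (𝓝 0)) (has : Tendsto (fun n ↦ a n * s n ^ γ) l atTop) :
    Tendsto s l atTop := by
  have hpow : Tendsto (fun n ↦ s n ^ γ) l atTop := by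
    refine tendsto_atTop_mono' l ?_ has
    filter_upwards [ha.eventually_le_const one_pos] with n han
    exact mul_le_of_le_one_left (Real.rpow_nonneg (hs n) γ) han
  refine ((tendsto_rpow_atTop (inv_pos.2 hγ)).comp hpow).congr fun n ↦ ?_
  exact Real.rpow_rpow_inv (hs n) hγ.ne'

lemma eventually_forall_of_mul_norm_sub_le {E : Type*} [SeminormedAddCommGroup E] {x₀ : E}
    {R : α → E → Prop} (hs : Tendsto s l atTop) (hR : ∀ᶠ q in l ×ˢ 𝓝 x₀, R q.1 q.2) (M : ℝ) :
    ∀ᶠ n in l, ∀ x, s n * ‖x - x₀‖ ≤ M → R n x := by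
  obtain ⟨Q, hQ, N, hN, hQN⟩ := eventually_prod_iff.1 hR
  obtain ⟨r, hr, hball⟩ := Metric.eventually_nhds_iff.1 hN
  filter_upwards [hQ, hs.eventually_gt_atTop (M / r), hs.eventually_gt_atTop 0]
    with n hQn hsr hspos x hx
  refine hQN hQn (hball ?_)
  rw [dist_eq_norm]
  rw [div_lt_iff₀ hr] at hsr
  exact lt_of_mul_lt_mul_left (hx.trans_lt hsr) hspos.le

lemma eventually_div_rpow_le_of_ne_zero {x₀ η : ℝ} (hs : Tendsto s l atTop)
    (ha : Tendsto a l (𝓝 0)) (hx₀ : x₀ ≠ 0) (hη : 0 < η) (M : ℝ) :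
    ∀ᶠ n in l, ∀ x, s n * ‖x - x₀‖ ≤ M → x ≠ 0 ∧ a n / |x| ^ γ ≤ η := by
  have habs : Tendsto (fun x : ℝ ↦ |x| ^ γ) (𝓝 x₀) (𝓝 (|x₀| ^ γ)) :=
    (continuous_abs.tendsto x₀).rpow_const (Or.inl (abs_ne_zero.2 hx₀))
  have hratio : Tendsto (fun q : α × ℝ ↦ a q.1 / |q.2| ^ γ) (l ×ˢ 𝓝 x₀) (𝓝 (0 / |x₀| ^ γ)) :=
    (ha.comp tendsto_fst).div (habs.comp tendsto_snd)
      (Real.rpow_pos_of_pos (abs_pos.2 hx₀) γ).ne'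
  rw [zero_div] at hratio
  exact eventually_forall_of_mul_norm_sub_le hs
    ((tendsto_snd.eventually_ne hx₀).and (hratio.eventually_le_const hη)) M

lemma eventually_lt_div_rpow_of_mul_abs_le {R : ℝ} (hs : Tendsto s l atTop) (hγ : 0 ≤ γ)
    (has : Tendsto (fun n ↦ a n * s n ^ γ) l atTop) (hR : 0 ≤ R) (M : ℝ) :
    ∀ᶠ n in l, ∀ x ≠ 0, s n * |x| ≤ M → R < a n / |x| ^ γ := by
  filter_upwards [hs.eventually_gt_atTop 0, has.eventually_gt_atTop (R * M ^ γ)]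
    with n hspos hlarge x hx hxM
  have hpow : |x| ^ γ * s n ^ γ ≤ M ^ γ := by
    rw [← Real.mul_rpow (abs_nonneg x) hspos.le, mul_comm]
    exact Real.rpow_le_rpow (by positivity) hxM hγ
  rw [lt_div_iff₀ (by positivity)]
  refine lt_of_mul_lt_mul_right ?_ (Real.rpow_nonneg hspos.le γ)
  calc R * |x| ^ γ * s n ^ γ ≤ R * M ^ γ := by
        rw [mul_assoc]
        exact mul_le_mul_of_nonneg_left hpow hR
    _ < a n * s n ^ γ := hlarge

lemma mul_sqrt_rpow_div_eq {lam x y : ℝ} (hx : 0 ≤ x) :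
    lam * √(x ^ γ / y) = lam / √y * √x ^ γ := by
  rw [Real.sqrt_div (Real.rpow_nonneg hx γ), Real.sqrt_eq_rpow (x ^ γ), Real.sqrt_eq_rpow x,
    ← Real.rpow_mul hx, ← Real.rpow_mul hx, mul_comm γ]
  ring

end AdaptiveWeights

section QuadraticForm

open scoped Matrix.Norms.L2Operator

variable {ι : Type*} [Fintype ι]

lemma abs_dotProduct_le_norm_mul_norm (u v : EuclideanSpace ℝ ι) :
    |u.ofLp ⬝ᵥ v.ofLp| ≤ ‖u‖ * ‖v‖ := by
  simpa [EuclideanSpace.inner_eq_star_dotProduct, mul_comm] using abs_real_inner_le_norm v u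

lemma abs_mulVec_apply_le [DecidableEq ι] (D : Matrix ι ι ℝ) (u : EuclideanSpace ℝ ι)
    (j : ι) : |(D *ᵥ u.ofLp) j| ≤ ‖D‖ * ‖u‖ :=
  (PiLp.norm_apply_le (WithLp.toLp 2 (D *ᵥ u.ofLp)) j).trans (l2_opNorm_mulVec D u)

lemma abs_dotProduct_mulVec_le [DecidableEq ι] (D : Matrix ι ι ℝ) (u : EuclideanSpace ℝ ι) :
    |u.ofLp ⬝ᵥ D *ᵥ u.ofLp| ≤ ‖D‖ * ‖u‖ ^ 2 := by
  calc |u.ofLp ⬝ᵥ D *ᵥ u.ofLp| ≤ ‖u‖ * ‖WithLp.toLp 2 (D *ᵥ u.ofLp)‖ :=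
        abs_dotProduct_le_norm_mul_norm u (WithLp.toLp 2 (D *ᵥ u.ofLp))
    _ ≤ ‖u‖ * (‖D‖ * ‖u‖) := by
        gcongr
        exact l2_opNorm_mulVec D u
    _ = ‖D‖ * ‖u‖ ^ 2 := by ring

lemma exists_pos_mul_norm_sq_le_dotProduct_mulVec {C : Matrix ι ι ℝ} (hC : C.PosDef) :
    ∃ c > 0, ∀ u : EuclideanSpace ℝ ι, c * ‖u‖ ^ 2 ≤ u.ofLp ⬝ᵥ C *ᵥ u.ofLp := by
  have hcont : Continuous fun u : EuclideanSpace ℝ ι ↦ u.ofLp ⬝ᵥ C *ᵥ u.ofLp := by fun_prop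
  obtain ⟨c, hc, hsphere⟩ := (isCompact_sphere (0 : EuclideanSpace ℝ ι) 1).exists_forall_le'
    hcont.continuousOn (a := 0) fun u hu ↦ by
      have hne : u.ofLp ≠ 0 := by
        simpa using ne_zero_of_mem_unit_sphere ⟨u, hu⟩
      simpa using hC.dotProduct_mulVec_pos hne
  refine ⟨c, hc, fun u ↦ ?_⟩
  rcases eq_or_ne u 0 with rfl | hu
  · simp
  have hunit := hsphere (‖u‖⁻¹ • u) (by simp [norm_smul, hu])
  rw [WithLp.ofLp_smul, mulVec_smul, smul_dotProduct, dotProduct_smul, smul_smul, smul_eq_mul,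
    ← mul_inv, ← sq, ← div_eq_inv_mul, le_div_iff₀ (by positivity)] at hunit
  exact hunit

lemma exists_pos_eventually_mul_norm_sq_le {α : Type*} {l : Filter α} {G : α → Matrix ι ι ℝ}
    {C : Matrix ι ι ℝ} (hC : C.PosDef) (hG : Tendsto G l (𝓝 C)) :
    ∃ c > 0, ∀ᶠ n in l, ∀ u : EuclideanSpace ℝ ι, c * ‖u‖ ^ 2 ≤ u.ofLp ⬝ᵥ G n *ᵥ u.ofLp := by
  classical
  obtain ⟨c, hc, hcoercive⟩ := exists_pos_mul_norm_sq_le_dotProduct_mulVec hC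
  refine ⟨c / 2, half_pos hc, ?_⟩
  filter_upwards [(tendsto_iff_norm_sub_tendsto_zero.1 hG).eventually_le_const (half_pos hc)]
    with n hn u
  have hperturb : |u.ofLp ⬝ᵥ G n *ᵥ u.ofLp - u.ofLp ⬝ᵥ C *ᵥ u.ofLp| ≤ c / 2 * ‖u‖ ^ 2 := by
    rw [← dotProduct_sub, ← sub_mulVec]
    exact (abs_dotProduct_mulVec_le _ u).trans (by gcongr)
  linarith [hcoercive u, (abs_le.1 hperturb).1]

end QuadraticForm

section OracleMatrix

variable {ι : Type*}

/-- The principal submatrix `C_SS`. -/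
abbrev principalBlock (S : Finset ι) (C : Matrix ι ι ℝ) : Matrix S S ℝ :=
  C.submatrix (fun i : S ↦ (i : ι)) (fun j : S ↦ (j : ι))

variable [DecidableEq ι]

lemma isUnit_det_principalBlock {C : Matrix ι ι ℝ} (hC : C.PosDef) (S : Finset ι) :
    IsUnit (principalBlock S C).det :=
  (hC.submatrix Subtype.val_injective).det_pos.ne'.isUnit

variable [Fintype ι]

/-- The matrix of `v ↦ C_SS⁻¹ v_S`. It maps the normalized score to the leading term of the
rescaled error on the active set `S`. -/
noncomputable def oracleMatrix (S : Finset ι) (C : Matrix ι ι ℝ) : Matrix S ι ℝ :=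
  (principalBlock S C)⁻¹ * (1 : Matrix ι ι ℝ).submatrix (fun i : S ↦ (i : ι)) id

lemma oracleMatrix_mulVec (S : Finset ι) (C : Matrix ι ι ℝ) (v : ι → ℝ) :
    oracleMatrix S C *ᵥ v = (principalBlock S C)⁻¹ *ᵥ fun j : S ↦ v j := by
  rw [oracleMatrix, ← mulVec_mulVec]
  congr 1
  ext j
  simp [mulVec, dotProduct, one_apply]

lemma oracleMatrix_mulVec_mulVec {C : Matrix ι ι ℝ} (hC : C.PosDef) {S : Finset ι} {u : ι → ℝ}
    (hu : ∀ j ∉ S, u j = 0) : oracleMatrix S C *ᵥ (C *ᵥ u) = fun j : S ↦ u j := by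
  have hblock : (fun i : S ↦ (C *ᵥ u) i) = principalBlock S C *ᵥ fun j : S ↦ u j := by
    ext i
    simp only [mulVec, dotProduct, submatrix_apply]
    rw [Finset.sum_coe_sort S fun j ↦ C i j * u j]
    refine (Finset.sum_subset (Finset.subset_univ S) fun j _ hj ↦ ?_).symm
    rw [hu j hj, mul_zero]
  rw [oracleMatrix_mulVec, hblock, mulVec_mulVec,
    nonsing_inv_mul _ (isUnit_det_principalBlock hC S), one_mulVec]

lemma oracleMatrix_mul_mul_transpose {C : Matrix ι ι ℝ} (hC : C.PosDef) (S : Finset ι) :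
    oracleMatrix S C * C * (oracleMatrix S C)ᵀ = (principalBlock S C)⁻¹ := by
  set A := principalBlock S C with hA
  set R := (1 : Matrix ι ι ℝ).submatrix (fun i : S ↦ (i : ι)) id
  have hblock : R * C * Rᵀ = A := by
    ext i j
    simp [R, hA, mul_apply, one_apply]
  have hsymm : (A⁻¹)ᵀ = A⁻¹ := by
    have hA : A.PosDef := hC.submatrix Subtype.val_injective
    simpa [conjTranspose_eq_transpose_of_trivial] using hA.inv.isHermitian.eq
  calc oracleMatrix S C * C * (oracleMatrix S C)ᵀ
      = A⁻¹ * (R * C * Rᵀ) * (A⁻¹)ᵀ := by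
        rw [oracleMatrix, transpose_mul]
        simp only [Matrix.mul_assoc, ← hA]
        rfl
    _ = A⁻¹ := by
        rw [hblock, hsymm, nonsing_inv_mul A (isUnit_det_principalBlock hC S), Matrix.one_mul]

lemma exists_pos_norm_oracleMatrix_mulVec_lt (S : Finset ι) (C : Matrix ι ι ℝ) {η : ℝ}
    (hη : 0 < η) :
    ∃ δ > 0, ∀ v : ι → ℝ, (∀ j ∈ S, |v j| < δ) →
      ‖(WithLp.toLp 2 (oracleMatrix S C *ᵥ v) : EuclideanSpace ℝ S)‖ < η := by
  set A := principalBlock S C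
  have hcont : Continuous fun v : S → ℝ ↦ ‖(WithLp.toLp 2 (A⁻¹ *ᵥ v) : EuclideanSpace ℝ S)‖ := by
    fun_prop
  have hsmall : ∀ᶠ v in 𝓝 (0 : S → ℝ), ‖(WithLp.toLp 2 (A⁻¹ *ᵥ v) : EuclideanSpace ℝ S)‖ < η :=
    hcont.continuousAt.eventually_lt_const (by simpa using hη)
  obtain ⟨δ, hδ, hball⟩ := Metric.eventually_nhds_iff.1 hsmall
  refine ⟨δ, hδ, fun v hv ↦ ?_⟩
  rw [oracleMatrix_mulVec]
  refine hball ?_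
  rw [dist_zero_right, pi_norm_lt_iff hδ]
  exact fun j ↦ hv j j.2

end OracleMatrix

section TameFit

open scoped Matrix.Norms.L2Operator

variable {p : ℕ}

/-- The tuning regime of the oracle property: the penalty levels `lam n` are of smaller order than
`√n`, but the rates `s n` of the initial estimator are large enough for `lam n / √n * (s n) ^ γ`
to diverge. -/
structure IsOracleTuning (γ : ℝ) (s lam : ℕ → ℝ) : Prop where
  exponent_pos : 0 < γ
  rate_nonneg : ∀ n, 0 ≤ s n
  tendsto_zero : Tendsto (fun n : ℕ ↦ lam n / √(n : ℝ)) atTop (𝓝 0)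
  tendsto_atTop : Tendsto (fun n : ℕ ↦ lam n / √(n : ℝ) * s n ^ γ) atTop atTop

/-- A realization of the errors `e`, of the initial estimate `βinit` and of the Adaptive Lasso
estimate `b` for which the normalized score and the initial error scaled by `s` are at most `M`.
By tightness this is an event of probability close to `1` for large `M`. -/
structure IsTameFit {n : ℕ} (X : Matrix (Fin n) (Fin p) ℝ) (βstar : EuclideanSpace ℝ (Fin p))
    (γ s lam M : ℝ) (e : Fin n → ℝ) (βinit b : EuclideanSpace ℝ (Fin p)) : Prop where
  isAdaptiveLasso : IsAdaptiveLasso X (X *ᵥ βstar.ofLp + e) lam γ βinit b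
  norm_noiseScore_le : ‖noiseScore X e‖ ≤ M
  mul_norm_sub_le : s * ‖βinit - βstar‖ ≤ M

lemma eq_zero_of_notMem_activeSet {β : EuclideanSpace ℝ (Fin p)} {j : Fin p}
    (hj : j ∉ activeSet β) : β j = 0 := by
  simpa [activeSet] using hj

namespace IsOracleTuning

variable {γ : ℝ} {s lam : ℕ → ℝ}

lemma tendsto_rate_atTop (h : IsOracleTuning γ s lam) : Tendsto s atTop atTop :=
  tendsto_atTop_of_tendsto_mul_rpow h.rate_nonneg h.exponent_pos h.tendsto_zero h.tendsto_atTop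

lemma eventually_penalty_pos (h : IsOracleTuning γ s lam) : ∀ᶠ n in atTop, 0 < lam n := by
  filter_upwards [h.tendsto_atTop.eventually_gt_atTop 0] with n hn
  have hratio := pos_of_mul_pos_left hn (Real.rpow_nonneg (h.rate_nonneg n) γ)
  exact pos_of_mul_pos_left hratio (by positivity)

lemma eventually_active_weight_le (h : IsOracleTuning γ s lam)
    (βstar : EuclideanSpace ℝ (Fin p)) (M : ℝ) {η : ℝ} (hη : 0 < η) :
    ∀ᶠ n : ℕ in atTop, ∀ x : EuclideanSpace ℝ (Fin p), s n * ‖x - βstar‖ ≤ M →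
      ∀ j ∈ activeSet βstar, x j ≠ 0 ∧ lam n / |x j| ^ γ / √(n : ℝ) ≤ η := by
  have hcoord : ∀ᶠ n : ℕ in atTop, ∀ j ∈ activeSet βstar, ∀ x : ℝ,
      s n * ‖x - βstar j‖ ≤ M → x ≠ 0 ∧ lam n / √(n : ℝ) / |x| ^ γ ≤ η :=
    (Finset.eventually_all _).2 fun j hj ↦ eventually_div_rpow_le_of_ne_zero
      h.tendsto_rate_atTop h.tendsto_zero (Finset.mem_filter.1 hj).2 hη M
  filter_upwards [hcoord] with n hn x hx j hj
  rw [div_right_comm]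
  refine hn j hj (x j) (le_trans ?_ hx)
  exact mul_le_mul_of_nonneg_left (PiLp.norm_apply_le (x - βstar) j) (h.rate_nonneg n)

lemma eventually_lt_inactive_weight (h : IsOracleTuning γ s lam)
    (βstar : EuclideanSpace ℝ (Fin p)) (M : ℝ) {R : ℝ} (hR : 0 ≤ R) :
    ∀ᶠ n : ℕ in atTop, ∀ x : EuclideanSpace ℝ (Fin p), s n * ‖x - βstar‖ ≤ M →
      ∀ j ∉ activeSet βstar, x j ≠ 0 → R < lam n / |x j| ^ γ / √(n : ℝ) := by
  filter_upwards [eventually_lt_div_rpow_of_mul_abs_le h.tendsto_rate_atTop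
    h.exponent_pos.le h.tendsto_atTop hR M] with n hn x hx j hj hxj
  rw [div_right_comm]
  refine hn (x j) hxj (le_trans ?_ hx)
  refine mul_le_mul_of_nonneg_left ?_ (h.rate_nonneg n)
  simpa [eq_zero_of_notMem_activeSet hj] using PiLp.norm_apply_le (x - βstar) j

end IsOracleTuning

namespace IsTameFit

variable {n : ℕ} {X : Matrix (Fin n) (Fin p) ℝ} {βstar βinit b : EuclideanSpace ℝ (Fin p)}
  {γ s lam M : ℝ} {e : Fin n → ℝ}

lemma mul_norm_rescaledError_le (h : IsTameFit X βstar γ s lam M e βinit b) (hn : 0 < n)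
    (hlam : 0 < lam) (hγ : 0 < γ) {c η : ℝ} (hη : 0 ≤ η)
    (hc : ∀ u : EuclideanSpace ℝ (Fin p), c * ‖u‖ ^ 2 ≤ u.ofLp ⬝ᵥ normalizedGram X *ᵥ u.ofLp)
    (hweight : ∀ j ∈ activeSet βstar, βinit j ≠ 0 ∧ lam / |βinit j| ^ γ / √(n : ℝ) ≤ η) :
    c * ‖√(n : ℝ) • (b - βstar)‖ ≤ 2 * M + (activeSet βstar).card * η := by
  set u := √(n : ℝ) • (b - βstar)
  have hadmissible (j : Fin p) (hj : βinit j = 0) : βstar j = 0 :=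
    eq_zero_of_notMem_activeSet fun hjS ↦ (hweight j hjS).1 hj
  have hbasic := (h.isAdaptiveLasso.isWeightedLasso hn hlam hγ).rescaledError_dotProduct_le hn
    (fun j ↦ by positivity) (fun j hj ↦ hadmissible j (not_not.1 hj))
    fun j ↦ eq_zero_of_notMem_activeSet
  have hscore : u.ofLp ⬝ᵥ (noiseScore X e).ofLp ≤ ‖u‖ * M :=
    (le_abs_self _).trans ((abs_dotProduct_le_norm_mul_norm _ _).trans
      (mul_le_mul_of_nonneg_left h.norm_noiseScore_le (norm_nonneg u)))
  have hpenalty : ∑ j ∈ activeSet βstar, lam / |βinit j| ^ γ / √(n : ℝ) * |u j| ≤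
      (activeSet βstar).card * (η * ‖u‖) := by
    rw [← nsmul_eq_mul]
    refine Finset.sum_le_card_nsmul _ _ _ fun j hj ↦ ?_
    exact mul_le_mul (hweight j hj).2 (PiLp.norm_apply_le u j) (abs_nonneg _) hη
  rcases (norm_nonneg u).eq_or_lt' with hzero | hpos
  · have hM : 0 ≤ M := (norm_nonneg _).trans h.norm_noiseScore_le
    rw [hzero, mul_zero]
    positivity
  refine le_of_mul_le_mul_right ?_ hpos
  linarith [hc u]

end IsTameFit

variable {X : (n : ℕ) → Matrix (Fin n) (Fin p) ℝ} {C : Matrix (Fin p) (Fin p) ℝ}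
  {γ : ℝ} {s lam : ℕ → ℝ}

lemma eventually_activeSet_subset (βstar : EuclideanSpace ℝ (Fin p)) (U : ℝ) :
    ∀ᶠ n : ℕ in atTop, ∀ b : EuclideanSpace ℝ (Fin p), ‖√(n : ℝ) • (b - βstar)‖ ≤ U →
      activeSet βstar ⊆ activeSet b := by
  have hopen : ∀ᶠ b in 𝓝 βstar, activeSet βstar ⊆ activeSet b := by
    have hcoord : ∀ᶠ b in 𝓝 βstar, ∀ j ∈ activeSet βstar, b j ≠ 0 :=
      (Finset.eventually_all _).2 fun j hj ↦
        (PiLp.continuous_apply 2 _ j).continuousAt.eventually_ne (Finset.mem_filter.1 hj).2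
    filter_upwards [hcoord] with b hb j hj
    exact Finset.mem_filter.2 ⟨Finset.mem_univ j, hb j hj⟩
  have hsqrt : Tendsto (fun n : ℕ ↦ √(n : ℝ)) atTop atTop :=
    Real.tendsto_sqrt_atTop.comp tendsto_natCast_atTop_atTop
  filter_upwards [eventually_forall_of_mul_norm_sub_le
    (R := fun _ b ↦ activeSet βstar ⊆ activeSet b) hsqrt (tendsto_snd.eventually hopen) U]
    with n hn b hb
  refine hn b ?_
  rwa [norm_smul, Real.norm_of_nonneg (Real.sqrt_nonneg _)] at hb

namespace IsOracleTuning

lemma exists_eventually_norm_rescaledError_le (h : IsOracleTuning γ s lam) (hC : C.PosDef)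
    (hXC : Tendsto (fun n ↦ normalizedGram (X n)) atTop (𝓝 C))
    (βstar : EuclideanSpace ℝ (Fin p)) (M : ℝ) :
    ∃ U, ∀ᶠ n : ℕ in atTop, ∀ e βinit b, IsTameFit (X n) βstar γ (s n) (lam n) M e βinit b →
      ‖√(n : ℝ) • (b - βstar)‖ ≤ U := by
  obtain ⟨c, hc, hcoercive⟩ := exists_pos_eventually_mul_norm_sq_le hC hXC
  refine ⟨(2 * M + (activeSet βstar).card * 1) / c, ?_⟩
  filter_upwards [hcoercive, h.eventually_active_weight_le βstar M one_pos,
    h.eventually_penalty_pos, eventually_gt_atTop 0] with n hcn hweight hlam hn e βinit b hfit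
  rw [le_div_iff₀' hc]
  exact hfit.mul_norm_rescaledError_le hn hlam h.exponent_pos zero_le_one hcn
    (hweight βinit hfit.mul_norm_sub_le)

lemma eventually_activeSet_eq (h : IsOracleTuning γ s lam) (hC : C.PosDef)
    (hXC : Tendsto (fun n ↦ normalizedGram (X n)) atTop (𝓝 C))
    (βstar : EuclideanSpace ℝ (Fin p)) (M : ℝ) :
    ∀ᶠ n : ℕ in atTop, ∀ e βinit b, IsTameFit (X n) βstar γ (s n) (lam n) M e βinit b →
      activeSet b = activeSet βstar := by
  obtain ⟨U, hU⟩ := h.exists_eventually_norm_rescaledError_le hC hXC βstar M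
  filter_upwards [hU, eventually_activeSet_subset βstar U, h.eventually_penalty_pos,
    h.eventually_lt_inactive_weight βstar M (R := 2 * (|M| + (‖C‖ + 1) * |U|)) (by positivity),
    hXC.norm.eventually_le_const (lt_add_one _), eventually_gt_atTop 0]
    with n hU hsubset hlam hweight hgram hn e βinit b hfit
  refine subset_antisymm (fun j hj ↦ ?_) (hsubset b (hU e βinit b hfit))
  by_contra hjS
  have hbj : b j ≠ 0 := (Finset.mem_filter.1 hj).2
  have hlasso := hfit.isAdaptiveLasso.isWeightedLasso hn hlam h.exponent_pos
  have hinit : βinit j ≠ 0 := fun hzero ↦ hbj (hlasso.eq_zero j (not_not.2 hzero))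
  have hlower := hweight βinit hfit.mul_norm_sub_le j hjS hinit
  have hgradient : |noiseScore (X n) e j -
      (normalizedGram (X n) *ᵥ (√(n : ℝ) • (b - βstar)).ofLp) j| ≤ |M| + (‖C‖ + 1) * |U| :=
    calc _ ≤ |noiseScore (X n) e j| +
          |(normalizedGram (X n) *ᵥ (√(n : ℝ) • (b - βstar)).ofLp) j| := abs_sub _ _
      _ ≤ ‖noiseScore (X n) e‖ + ‖normalizedGram (X n)‖ * ‖√(n : ℝ) • (b - βstar)‖ :=
          add_le_add (PiLp.norm_apply_le (noiseScore (X n) e) j) (abs_mulVec_apply_le _ _ j)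
      _ ≤ |M| + (‖C‖ + 1) * |U| := by
          gcongr
          · exact hfit.norm_noiseScore_le.trans (le_abs_self M)
          · exact (hU e βinit b hfit).trans (le_abs_self U)
  linarith [hlasso.weight_div_sqrt_le hn hbj]

lemma eventually_norm_sub_leadingTerm_lt (h : IsOracleTuning γ s lam) (hC : C.PosDef)
    (hXC : Tendsto (fun n ↦ normalizedGram (X n)) atTop (𝓝 C))
    (βstar : EuclideanSpace ℝ (Fin p)) (M : ℝ) {η : ℝ} (hη : 0 < η) :
    ∀ᶠ n : ℕ in atTop, ∀ e βinit b, IsTameFit (X n) βstar γ (s n) (lam n) M e βinit b →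
      ‖√(n : ℝ) • (subvector (activeSet βstar) b - subvector (activeSet βstar) βstar) -
        WithLp.toLp 2 (oracleMatrix (activeSet βstar) C *ᵥ (noiseScore (X n) e).ofLp)‖ < η := by
  obtain ⟨U, hU⟩ := h.exists_eventually_norm_rescaledError_le hC hXC βstar M
  obtain ⟨δ, hδ, hsmall⟩ := exists_pos_norm_oracleMatrix_mulVec_lt (activeSet βstar) C hη
  have hgram : Tendsto (fun n ↦ ‖normalizedGram (X n) - C‖ * U) atTop (𝓝 0) := by
    simpa using (tendsto_iff_norm_sub_tendsto_zero.1 hXC).mul_const U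
  filter_upwards [hU, h.eventually_activeSet_eq hC hXC βstar M, h.eventually_penalty_pos,
    h.eventually_active_weight_le βstar M hδ, hgram.eventually_lt_const (half_pos hδ),
    eventually_gt_atTop 0] with n hU hactive hlam hweight hgram hn e βinit b hfit
  set u := √(n : ℝ) • (b - βstar)
  set W := noiseScore (X n) e
  have hu (j : Fin p) (hj : j ∉ activeSet βstar) : u.ofLp j = 0 := by
    have hbj := eq_zero_of_notMem_activeSet ((hactive e βinit b hfit).symm ▸ hj)
    simp [u, hbj, eq_zero_of_notMem_activeSet hj]
  have hgradient (j : Fin p) (hj : j ∈ activeSet βstar) :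
      |(C *ᵥ u.ofLp - W.ofLp) j| < δ := by
    obtain ⟨hinit, hη⟩ := hweight βinit hfit.mul_norm_sub_le j hj
    have hkkt := (hfit.isAdaptiveLasso.isWeightedLasso hn hlam
      h.exponent_pos).two_mul_abs_noiseScore_sub_le hn hinit (by positivity)
    have hperturb := abs_mulVec_apply_le (normalizedGram (X n) - C) u j
    have hbound := mul_le_mul_of_nonneg_left (hU e βinit b hfit)
      (norm_nonneg (normalizedGram (X n) - C))
    rw [sub_mulVec, Pi.sub_apply] at hperturb
    rw [Pi.sub_apply, abs_sub_comm]
    calc _ ≤ _ := abs_sub_le _ ((normalizedGram (X n) *ᵥ u.ofLp) j) _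
      _ < δ := by linarith
  convert hsmall _ hgradient using 2
  rw [mulVec_sub, oracleMatrix_mulVec_mulVec hC hu, WithLp.toLp_sub]
  rfl

end IsOracleTuning

end TameFit

section GaussianScore

lemma posSemidef_normalizedGram {n : ℕ} {ι : Type*} [Finite ι] (X : Matrix (Fin n) ι ℝ) :
    (normalizedGram X).PosSemidef := by
  have hgram : (Xᵀ * X).PosSemidef := by
    simpa [conjTranspose_eq_transpose_of_trivial] using posSemidef_conjTranspose_mul_self X
  exact hgram.smul (by positivity)

variable {ι κ : Type*} [Fintype ι] [DecidableEq ι] [Fintype κ] [DecidableEq κ]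

lemma map_toLpLin_multivariateGaussian (B : Matrix κ ι ℝ) (μ : EuclideanSpace ℝ ι)
    {S : Matrix ι ι ℝ} (hS : S.PosSemidef) :
    (multivariateGaussian μ S).map (toLpLin 2 2 B) =
      multivariateGaussian (toLpLin 2 2 B μ) (B * S * Bᵀ) := by
  have hBS : (B * S * Bᵀ).PosSemidef := by
    simpa [conjTranspose_eq_transpose_of_trivial] using hS.mul_mul_conjTranspose_same B
  have hmeas : Measurable (toLpLin 2 2 B : EuclideanSpace ℝ ι → EuclideanSpace ℝ κ) :=
    (LinearMap.continuous_of_finiteDimensional _).measurable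
  have := Measure.isProbabilityMeasure_map (μ := multivariateGaussian μ S) hmeas.aemeasurable
  refine Measure.ext_of_charFun (funext fun x ↦ ?_)
  have hadjoint (v : EuclideanSpace ℝ ι) :
      inner ℝ (toLpLin 2 2 B v) x = inner ℝ v (toLpLin 2 2 Bᵀ x) := by
    simp [EuclideanSpace.inner_eq_star_dotProduct, dotProduct_mulVec, mulVec_transpose]
  have hmap : charFun ((multivariateGaussian μ S).map (toLpLin 2 2 B)) x =
      charFun (multivariateGaussian μ S) (toLpLin 2 2 Bᵀ x) := by
    rw [charFun_apply, charFun_apply, integral_map hmeas.aemeasurable (by fun_prop)]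
    simp only [hadjoint]
  rw [hmap, charFun_multivariateGaussian hS, charFun_multivariateGaussian hBS,
    real_inner_comm, ← hadjoint, real_inner_comm]
  have hform : (toLpLin 2 2 Bᵀ x).ofLp ⬝ᵥ S *ᵥ (toLpLin 2 2 Bᵀ x).ofLp =
      x.ofLp ⬝ᵥ (B * S * Bᵀ) *ᵥ x.ofLp := by
    rw [ofLp_toLpLin, toLin'_apply, ← mulVec_mulVec, ← mulVec_mulVec, dotProduct_mulVec x.ofLp,
      ← mulVec_transpose]
  rw [hform]

lemma hasLaw_toLp_multivariateGaussian {Ω : Type*} [MeasurableSpace Ω] {P : Measure Ω}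
    [IsProbabilityMeasure P] {e : ι → Ω → ℝ} {v : ℝ≥0}
    (hlaw : ∀ i, HasLaw (e i) (gaussianReal 0 v) P) (hindep : iIndepFun e P) :
    HasLaw (fun ω ↦ WithLp.toLp 2 fun i ↦ e i ω)
      (multivariateGaussian 0 ((v : ℝ) • (1 : Matrix ι ι ℝ))) P := by
  have hmeas (i : ι) : AEMeasurable (e i) P := (hlaw i).aemeasurable
  have hmeas' : AEMeasurable (fun ω ↦ WithLp.toLp 2 fun i ↦ e i ω) P :=
    (by fun_prop : Measurable (WithLp.toLp 2 : (ι → ℝ) → EuclideanSpace ℝ ι)).comp_aemeasurable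
      (aemeasurable_pi_lambda _ hmeas)
  refine ⟨hmeas', ?_⟩
  have := Measure.isProbabilityMeasure_map hmeas'
  refine Measure.ext_of_charFun (funext fun x ↦ ?_)
  have hprod := (iIndepFun_iff_charFun_pi hmeas).1 hindep x
  have hpsd : ((v : ℝ) • (1 : Matrix ι ι ℝ)).PosSemidef := PosSemidef.one.smul v.2
  rw [hprod, charFun_multivariateGaussian hpsd]
  simp only [(hlaw _).map_eq, charFun_gaussianReal]
  rw [← Complex.exp_sum]
  congr 1
  simp only [Complex.ofReal_zero, mul_zero, zero_mul, zero_sub, inner_zero_right, smul_mulVec,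
    one_mulVec, dotProduct, Pi.smul_apply, smul_eq_mul]
  push_cast
  rw [Finset.sum_div, ← Finset.sum_neg_distrib]
  exact Finset.sum_congr rfl fun i _ ↦ by ring

lemma tendsto_multivariateGaussian {S : ℕ → Matrix ι ι ℝ} {T : Matrix ι ι ℝ}
    (μ : EuclideanSpace ℝ ι) (hS : ∀ n, (S n).PosSemidef) (hT : T.PosSemidef)
    (h : Tendsto S atTop (𝓝 T)) :
    Tendsto (β := ProbabilityMeasure (EuclideanSpace ℝ ι))
      (fun n ↦ ⟨multivariateGaussian μ (S n), inferInstance⟩) atTop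
      (𝓝 ⟨multivariateGaussian μ T, inferInstance⟩) := by
  refine ProbabilityMeasure.tendsto_of_tendsto_charFun fun x ↦ ?_
  simp only [ProbabilityMeasure.coe_mk, charFun_multivariateGaussian hT,
    charFun_multivariateGaussian (hS _)]
  have hform : Tendsto (fun n ↦ x.ofLp ⬝ᵥ S n *ᵥ x.ofLp) atTop (𝓝 (x.ofLp ⬝ᵥ T *ᵥ x.ofLp)) :=
    ((by fun_prop : Continuous fun D : Matrix ι ι ℝ ↦ x.ofLp ⬝ᵥ D *ᵥ x.ofLp).tendsto T).comp h
  have hform' := (Complex.continuous_ofReal.tendsto _).comp hform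
  exact (Complex.continuous_exp.tendsto _).comp
    (tendsto_const_nhds.sub (hform'.div_const 2))

lemma hasLaw_noiseScore {Ω : Type*} [MeasurableSpace Ω] {P : Measure Ω} [IsProbabilityMeasure P]
    {n : ℕ} (X : Matrix (Fin n) ι ℝ) {e : Fin n → Ω → ℝ} {v : ℝ≥0}
    (hlaw : ∀ i, HasLaw (e i) (gaussianReal 0 v) P) (hindep : iIndepFun e P) :
    HasLaw (fun ω ↦ noiseScore X fun i ↦ e i ω)
      (multivariateGaussian 0 ((v : ℝ) • normalizedGram X)) P := by
  have hcov : ((√(n : ℝ))⁻¹ • Xᵀ) * ((v : ℝ) • (1 : Matrix (Fin n) (Fin n) ℝ)) *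
      ((√(n : ℝ))⁻¹ • Xᵀ)ᵀ = (v : ℝ) • normalizedGram X := by
    simp only [transpose_smul, transpose_transpose, Matrix.mul_smul, Matrix.smul_mul,
      Matrix.mul_one, smul_smul, normalizedGram]
    congr 1
    rw [mul_left_comm, ← mul_inv, Real.mul_self_sqrt n.cast_nonneg, one_div]
  have hnoise := hasLaw_toLp_multivariateGaussian hlaw hindep
  have hlin : HasLaw (toLpLin 2 2 ((√(n : ℝ))⁻¹ • Xᵀ))
      (multivariateGaussian 0 ((v : ℝ) • normalizedGram X))
      (multivariateGaussian 0 ((v : ℝ) • (1 : Matrix (Fin n) (Fin n) ℝ))) := by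
    refine ⟨(LinearMap.continuous_of_finiteDimensional _).aemeasurable, ?_⟩
    have hpsd : ((v : ℝ) • (1 : Matrix (Fin n) (Fin n) ℝ)).PosSemidef := PosSemidef.one.smul v.2
    rw [map_toLpLin_multivariateGaussian ((√(n : ℝ))⁻¹ • Xᵀ) 0 hpsd, map_zero, hcov]
  convert hlin.comp hnoise using 2
  rw [Function.comp_apply, toLpLin_toLp, toLin'_apply, smul_mulVec, noiseScore]

lemma tendstoInDistribution_noiseScore {Ω : Type*} [MeasurableSpace Ω] {P : Measure Ω}
    [IsProbabilityMeasure P] {X : (n : ℕ) → Matrix (Fin n) ι ℝ} {C : Matrix ι ι ℝ}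
    {ε : (n : ℕ) → Fin n → Ω → ℝ} {v : ℝ≥0}
    (hlaw : ∀ n i, HasLaw (ε n i) (gaussianReal 0 v) P) (hindep : ∀ n, iIndepFun (ε n) P)
    (hC : C.PosSemidef) (hXC : Tendsto (fun n ↦ normalizedGram (X n)) atTop (𝓝 C)) :
    TendstoInDistribution (fun n ω ↦ noiseScore (X n) fun i ↦ ε n i ω) atTop
      (id : EuclideanSpace ℝ ι → EuclideanSpace ℝ ι) (fun _ ↦ P)
      (multivariateGaussian 0 ((v : ℝ) • C)) := by
  have hscore (n : ℕ) := hasLaw_noiseScore (X n) (hlaw n) (hindep n)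
  refine ⟨fun n ↦ (hscore n).aemeasurable, aemeasurable_id, ?_⟩
  simp only [(hscore _).map_eq, Measure.map_id]
  exact tendsto_multivariateGaussian 0 (fun n ↦ (posSemidef_normalizedGram (X n)).smul v.2)
    (hC.smul v.2) (hXC.const_smul (v : ℝ))

lemma tendstoInDistribution_toLpLin {Ω : Type*} [MeasurableSpace Ω] {P : Measure Ω}
    [IsProbabilityMeasure P] {α : Type*} {l : Filter α} {W : α → Ω → EuclideanSpace ℝ ι}
    {μ : EuclideanSpace ℝ ι} {S : Matrix ι ι ℝ} (B : Matrix κ ι ℝ) (hS : S.PosSemidef)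
    (h : TendstoInDistribution W l (id : EuclideanSpace ℝ ι → EuclideanSpace ℝ ι)
      (fun _ ↦ P) (multivariateGaussian μ S)) :
    TendstoInDistribution (fun n ω ↦ toLpLin 2 2 B (W n ω)) l
      (id : EuclideanSpace ℝ κ → EuclideanSpace ℝ κ) (fun _ ↦ P)
      (multivariateGaussian (toLpLin 2 2 B μ) (B * S * Bᵀ)) := by
  have himage := h.continuous_comp (LinearMap.continuous_of_finiteDimensional (toLpLin 2 2 B))
  refine ⟨himage.forall_aemeasurable, aemeasurable_id, ?_⟩
  have hlim := himage.tendsto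
  simp only [Function.comp_id, map_toLpLin_multivariateGaussian B μ hS] at hlim
  simpa only [Measure.map_id] using! hlim

end GaussianScore

section HighProbability

variable {Ω : Type*} [MeasurableSpace Ω] {P : Measure Ω}

/-- For large `M`, the events `A M n` eventually have probability close to `1` as `n → ∞`.
With `A M n ω := Z n ω ≤ M` this says that `Z n` is bounded from above in probability. -/
def HoldsWithHighProbability (P : Measure Ω) (A : ℝ → ℕ → Ω → Prop) : Prop :=
  ∀ δ : ℝ, 0 < δ → ∃ M : ℝ, ∀ᶠ n in atTop, P {ω | ¬ A M n ω} ≤ ENNReal.ofReal δ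

lemma isRootConsistent_iff {E : Type*} [NormedAddCommGroup E] {r : ℕ → ℕ} {T : ℕ → Ω → E} {θ : E} :
    IsRootConsistent P r T θ ↔
      HoldsWithHighProbability P fun M n ω ↦ √(r n : ℝ) * ‖T n ω - θ‖ ≤ M := by
  simp only [IsRootConsistent, HoldsWithHighProbability, not_le]

namespace HoldsWithHighProbability

variable {A B : ℝ → ℕ → Ω → Prop} {G : ℕ → Ω → Prop}

lemma imp (hA : HoldsWithHighProbability P A)
    (h : ∀ M, ∃ U, ∀ᶠ n in atTop, ∀ᵐ ω ∂P, A M n ω → B U n ω) :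
    HoldsWithHighProbability P B := by
  intro δ hδ
  obtain ⟨M, hM⟩ := hA δ hδ
  obtain ⟨U, hU⟩ := h M
  refine ⟨U, ?_⟩
  filter_upwards [hM, hU] with n hM hU
  refine (measure_mono_ae ?_).trans hM
  filter_upwards [hU] with ω hω
  exact mt hω

lemma and (hA : HoldsWithHighProbability P A) (hB : HoldsWithHighProbability P B)
    (hA_mono : ∀ n ω, Monotone fun M ↦ A M n ω) (hB_mono : ∀ n ω, Monotone fun M ↦ B M n ω) :
    HoldsWithHighProbability P fun M n ω ↦ A M n ω ∧ B M n ω := by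
  intro δ hδ
  obtain ⟨M, hM⟩ := hA (δ / 2) (half_pos hδ)
  obtain ⟨N, hN⟩ := hB (δ / 2) (half_pos hδ)
  refine ⟨max M N, ?_⟩
  filter_upwards [hM, hN] with n hM hN
  have hsubset : {ω | ¬ (A (max M N) n ω ∧ B (max M N) n ω)} ⊆
      {ω | ¬ A M n ω} ∪ {ω | ¬ B N n ω} := fun ω hω ↦ by
    by_contra hunion
    simp only [Set.mem_union, Set.mem_ofPred_eq, not_or, not_not] at hunion
    exact hω ⟨hA_mono n ω (le_max_left M N) hunion.1, hB_mono n ω (le_max_right M N) hunion.2⟩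
  calc P {ω | ¬ (A (max M N) n ω ∧ B (max M N) n ω)}
      ≤ P {ω | ¬ A M n ω} + P {ω | ¬ B N n ω} := (measure_mono hsubset).trans (measure_union_le _ _)
    _ ≤ ENNReal.ofReal (δ / 2) + ENNReal.ofReal (δ / 2) := add_le_add hM hN
    _ = ENNReal.ofReal δ := by
        rw [← ENNReal.ofReal_add (half_pos hδ).le (half_pos hδ).le, add_halves]

lemma tendsto_measure_not (hG : HoldsWithHighProbability P fun _ ↦ G) :
    Tendsto (fun n ↦ P {ω | ¬ G n ω}) atTop (𝓝 0) := by
  refine ENNReal.tendsto_nhds_zero.2 fun δ hδ ↦ ?_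
  obtain ⟨r, hr, hrδ⟩ := ENNReal.lt_iff_exists_nnreal_btwn.1 hδ
  obtain ⟨_, hbound⟩ := hG r (by exact_mod_cast hr)
  filter_upwards [hbound] with n hn
  exact hn.trans (by simpa using hrδ.le)

lemma tendsto_measure [IsProbabilityMeasure P] (hG : HoldsWithHighProbability P fun _ ↦ G) :
    Tendsto (fun n ↦ P {ω | G n ω}) atTop (𝓝 1) := by
  have hlower : Tendsto (fun n ↦ 1 - P {ω | ¬ G n ω}) atTop (𝓝 1) := by
    simpa using ENNReal.Tendsto.sub tendsto_const_nhds hG.tendsto_measure_not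
      (Or.inl ENNReal.one_ne_top)
  refine tendsto_of_tendsto_of_tendsto_of_le_of_le hlower tendsto_const_nhds (fun n ↦ ?_)
    fun n ↦ prob_le_one
  rw [tsub_le_iff_right, ← measure_univ (μ := P)]
  exact measure_univ_le_add_compl _

end HoldsWithHighProbability

lemma exists_measure_le_norm_lt {E : Type*} [NormedAddCommGroup E] [MeasurableSpace E]
    [OpensMeasurableSpace E] (μ : Measure E) [IsFiniteMeasure μ] {δ : ℝ≥0∞} (hδ : 0 < δ) :
    ∃ M : ℝ, μ {x | M ≤ ‖x‖} < δ := by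
  have hinter : ⋂ k : ℕ, {x : E | (k : ℝ) ≤ ‖x‖} = ∅ := by
    refine Set.eq_empty_of_forall_notMem fun x hx ↦ ?_
    obtain ⟨k, hk⟩ := exists_nat_gt ‖x‖
    exact hk.not_ge (Set.mem_iInter.1 hx k)
  have hlim : Tendsto (fun k : ℕ ↦ μ {x | (k : ℝ) ≤ ‖x‖}) atTop (𝓝 0) := by
    rw [← measure_empty (μ := μ), ← hinter]
    refine tendsto_measure_iInter_atTop
      (fun k ↦ (isClosed_le continuous_const continuous_norm).measurableSet.nullMeasurableSet)
      (fun k l hkl x (hx : (l : ℝ) ≤ ‖x‖) ↦ (Nat.cast_le.2 hkl).trans hx) ⟨0, measure_ne_top _ _⟩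
  obtain ⟨k, hk⟩ := (hlim.eventually_lt_const hδ).exists
  exact ⟨k, hk⟩

lemma holdsWithHighProbability_norm_le_of_tendstoInDistribution [IsProbabilityMeasure P]
    {Ω' E : Type*} [MeasurableSpace Ω'] {Q : Measure Ω'} [IsProbabilityMeasure Q]
    [NormedAddCommGroup E] [MeasurableSpace E] [OpensMeasurableSpace E] {W : ℕ → Ω → E} {Z : Ω' → E}
    (h : TendstoInDistribution W atTop Z (fun _ ↦ P) Q) :
    HoldsWithHighProbability P fun M n ω ↦ ‖W n ω‖ ≤ M := by
  intro δ hδ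
  have := Measure.isProbabilityMeasure_map h.aemeasurable_limit
  obtain ⟨M, hM⟩ := exists_measure_le_norm_lt (Q.map Z) (ENNReal.ofReal_pos.2 hδ)
  have hlimsup := ProbabilityMeasure.limsup_measure_closed_le_of_tendsto h.tendsto
    (isClosed_le continuous_const continuous_norm : IsClosed {x : E | M ≤ ‖x‖})
  refine ⟨M, ?_⟩
  filter_upwards [eventually_lt_of_limsup_lt (hlimsup.trans_lt hM)] with n hn
  rw [ProbabilityMeasure.coe_mk, Measure.map_apply_of_aemeasurable (h.forall_aemeasurable n)
    (isClosed_le continuous_const continuous_norm).measurableSet] at hn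
  refine (measure_mono fun ω hω ↦ ?_).trans hn.le
  exact (not_le.1 hω).le

end HighProbability

section OracleProperty

variable {Ω : Type*} [MeasurableSpace Ω] {P : Measure Ω} {p : ℕ}
  {X : (n : ℕ) → Matrix (Fin n) (Fin p) ℝ} {βstar : EuclideanSpace ℝ (Fin p)}
  {e : (n : ℕ) → Ω → Fin n → ℝ} {βinit βhat : ℕ → Ω → EuclideanSpace ℝ (Fin p)}
  {C : Matrix (Fin p) (Fin p) ℝ} {γ : ℝ} {s lam : ℕ → ℝ}

lemma holdsWithHighProbability_isTameFit
    (hfit : ∀ n, ∀ᵐ ω ∂P, IsAdaptiveLasso (X n) (X n *ᵥ βstar.ofLp + e n ω) (lam n) γ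
      (βinit n ω) (βhat n ω))
    (hscore : HoldsWithHighProbability P fun M n ω ↦ ‖noiseScore (X n) (e n ω)‖ ≤ M)
    (hinit : HoldsWithHighProbability P fun M n ω ↦ s n * ‖βinit n ω - βstar‖ ≤ M) :
    HoldsWithHighProbability P fun M n ω ↦
      IsTameFit (X n) βstar γ (s n) (lam n) M (e n ω) (βinit n ω) (βhat n ω) := by
  refine (hscore.and hinit (fun n ω M N hMN h ↦ h.trans hMN)
    (fun n ω M N hMN h ↦ h.trans hMN)).imp fun M ↦ ⟨M, .of_forall fun n ↦ ?_⟩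
  filter_upwards [hfit n] with ω hω hbound
  exact ⟨hω, hbound.1, hbound.2⟩

namespace IsOracleTuning

lemma tendsto_measure_activeSet_eq [IsProbabilityMeasure P] (h : IsOracleTuning γ s lam)
    (hC : C.PosDef) (hXC : Tendsto (fun n ↦ normalizedGram (X n)) atTop (𝓝 C))
    (htame : HoldsWithHighProbability P fun M n ω ↦
      IsTameFit (X n) βstar γ (s n) (lam n) M (e n ω) (βinit n ω) (βhat n ω)) :
    Tendsto (fun n ↦ P {ω | activeSet (βhat n ω) = activeSet βstar}) atTop (𝓝 1) := by
  refine (htame.imp fun M ↦ ⟨0, ?_⟩).tendsto_measure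
  filter_upwards [h.eventually_activeSet_eq hC hXC βstar M] with n hn
  exact .of_forall fun ω ↦ hn _ _ _

lemma isRootConsistent (h : IsOracleTuning γ s lam)
    (hC : C.PosDef) (hXC : Tendsto (fun n ↦ normalizedGram (X n)) atTop (𝓝 C))
    (htame : HoldsWithHighProbability P fun M n ω ↦
      IsTameFit (X n) βstar γ (s n) (lam n) M (e n ω) (βinit n ω) (βhat n ω)) :
    IsRootConsistent P (fun n ↦ n) βhat βstar := by
  refine isRootConsistent_iff.2 (htame.imp fun M ↦ ?_)
  obtain ⟨U, hU⟩ := h.exists_eventually_norm_rescaledError_le hC hXC βstar M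
  refine ⟨U, ?_⟩
  filter_upwards [hU] with n hn
  refine .of_forall fun ω hω ↦ ?_
  simpa only [norm_smul, Real.norm_of_nonneg (Real.sqrt_nonneg _)] using hn _ _ _ hω

lemma tendstoInMeasure_sub_leadingTerm (h : IsOracleTuning γ s lam)
    (hC : C.PosDef) (hXC : Tendsto (fun n ↦ normalizedGram (X n)) atTop (𝓝 C))
    (htame : HoldsWithHighProbability P fun M n ω ↦
      IsTameFit (X n) βstar γ (s n) (lam n) M (e n ω) (βinit n ω) (βhat n ω)) :
    TendstoInMeasure P
      (fun (n : ℕ) ω ↦ √(n : ℝ) • (subvector (activeSet βstar) (βhat n ω) -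
          subvector (activeSet βstar) βstar) -
        toLpLin 2 2 (oracleMatrix (activeSet βstar) C) (noiseScore (X n) (e n ω)))
      atTop 0 := by
  refine tendstoInMeasure_iff_norm.2 fun η hη ↦ ?_
  simp only [Pi.zero_apply, sub_zero, ← not_lt]
  refine (htame.imp fun M ↦ ⟨0, ?_⟩).tendsto_measure_not
  filter_upwards [h.eventually_norm_sub_leadingTerm_lt hC hXC βstar M hη] with n hn
  exact .of_forall fun ω ↦ hn _ _ _

end IsOracleTuning

lemma continuous_subvector (S : Finset (Fin p)) : Continuous (subvector S) := by
  unfold subvector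
  fun_prop

lemma tendstoInDistribution_oracleMatrix_noiseScore [IsProbabilityMeasure P] (hC : C.PosDef)
    {v : ℝ} (hv : 0 ≤ v) (S : Finset (Fin p))
    (h : TendstoInDistribution (fun n ω ↦ noiseScore (X n) (e n ω)) atTop
      (id : EuclideanSpace ℝ (Fin p) → EuclideanSpace ℝ (Fin p)) (fun _ ↦ P)
      (multivariateGaussian 0 (v • C))) :
    TendstoInDistribution
      (fun n ω ↦ toLpLin 2 2 (oracleMatrix S C) (noiseScore (X n) (e n ω))) atTop
      (id : EuclideanSpace ℝ S → EuclideanSpace ℝ S) (fun _ ↦ P)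
      (multivariateGaussian 0 (v • (principalBlock S C)⁻¹)) := by
  have hlim := tendstoInDistribution_toLpLin (oracleMatrix S C) (hC.posSemidef.smul hv) h
  rwa [map_zero, Matrix.mul_smul, Matrix.smul_mul, oracleMatrix_mul_mul_transpose hC] at hlim

end OracleProperty

theorem mainTheorem11_general {Ω : Type*} [MeasurableSpace Ω] (P : Measure Ω)
    [IsProbabilityMeasure P] {p : ℕ} (X : (n : ℕ) → Matrix (Fin n) (Fin p) ℝ)
    (βstar : EuclideanSpace ℝ (Fin p)) (σ : ℝ) (ε : (n : ℕ) → Fin n → Ω → ℝ)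
    (y : (n : ℕ) → Ω → Fin n → ℝ)
    (hy : ∀ n ω i, y n ω i = (X n *ᵥ βstar.ofLp) i + ε n i ω)
    (C : Matrix (Fin p) (Fin p) ℝ) (hC : C.PosDef)
    (hXC : Tendsto (fun n ↦ normalizedGram (X n)) atTop (𝓝 C))
    (hscore : TendstoInDistribution (fun n ω ↦ noiseScore (X n) fun i ↦ ε n i ω) atTop
      (id : EuclideanSpace ℝ (Fin p) → EuclideanSpace ℝ (Fin p)) (fun _ ↦ P)
      (multivariateGaussian 0 (σ ^ 2 • C)))
    (m : ℕ → ℕ) (βinit : ℕ → Ω → EuclideanSpace ℝ (Fin p))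
    (hβinit : IsRootConsistent P m βinit βstar)
    (γ : ℝ) (hγ : 0 < γ) (lam : ℕ → ℝ)
    (hlam_zero : Tendsto (fun n : ℕ ↦ lam n / √(n : ℝ)) atTop (𝓝 0))
    (hlam_top : Tendsto (fun n : ℕ ↦ lam n * √((m n : ℝ) ^ γ / (n : ℝ))) atTop atTop)
    (βhat : ℕ → Ω → EuclideanSpace ℝ (Fin p)) (hβhat_meas : ∀ n, AEMeasurable (βhat n) P)
    (hβhat : ∀ n, ∀ᵐ ω ∂P, IsAdaptiveLasso (X n) (y n ω) (lam n) γ (βinit n ω) (βhat n ω)) :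
    Tendsto (fun n ↦ P {ω | activeSet (βhat n ω) = activeSet βstar}) atTop (𝓝 1) ∧
    IsRootConsistent P (fun n ↦ n) βhat βstar ∧
    TendstoInDistribution
      (fun (n : ℕ) ω ↦ √(n : ℝ) • (subvector (activeSet βstar) (βhat n ω) -
        subvector (activeSet βstar) βstar))
      atTop (id : EuclideanSpace ℝ (activeSet βstar) → EuclideanSpace ℝ (activeSet βstar))
      (fun _ ↦ P) (multivariateGaussian 0 (σ ^ 2 • (principalBlock (activeSet βstar) C)⁻¹)) := by
  have htuning : IsOracleTuning γ (fun n ↦ √(m n : ℝ)) lam :=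
    ⟨hγ, fun n ↦ Real.sqrt_nonneg _, hlam_zero,
      by simpa only [mul_sqrt_rpow_div_eq (Nat.cast_nonneg _)] using hlam_top⟩
  have hmodel (n : ℕ) (ω : Ω) : y n ω = X n *ᵥ βstar.ofLp + fun i ↦ ε n i ω :=
    funext (hy n ω)
  have htame := holdsWithHighProbability_isTameFit (by simpa only [hmodel] using hβhat)
    (holdsWithHighProbability_norm_le_of_tendstoInDistribution hscore)
    (isRootConsistent_iff.1 hβinit)
  have hleading := tendstoInDistribution_oracleMatrix_noiseScore hC (sq_nonneg σ)
    (activeSet βstar) hscore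
  refine ⟨htuning.tendsto_measure_activeSet_eq hC hXC htame,
    htuning.isRootConsistent hC hXC htame,
    tendstoInDistribution_of_tendstoInMeasure_sub _ _ hleading
      (htuning.tendstoInMeasure_sub_leadingTerm hC hXC htame) fun n ↦ ?_⟩
  have hmeas : AEMeasurable (fun ω ↦ subvector (activeSet βstar) (βhat n ω)) P :=
    (continuous_subvector _).measurable.comp_aemeasurable (hβhat_meas n)
  exact (hmeas.sub_const _).const_smul √(n : ℝ)

theorem mainTheorem11 {Ω : Type*} [MeasurableSpace Ω] (P : Measure Ω) [IsProbabilityMeasure P]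
    {p : ℕ}
    -- the linear model `y = X β* + ε` with i.i.d. `N(0, σ²)` noise
    (X : (n : ℕ) → Matrix (Fin n) (Fin p) ℝ) (βstar : EuclideanSpace ℝ (Fin p)) (σ : ℝ≥0)
    (ε : (n : ℕ) → Fin n → Ω → ℝ)
    (hε_law : ∀ n i, HasLaw (ε n i) (gaussianReal 0 (σ ^ 2)) P)
    (hε_indep : ∀ n, iIndepFun (ε n) P)
    (y : (n : ℕ) → Ω → Fin n → ℝ)
    (hy : ∀ n ω i, y n ω i = (X n *ᵥ βstar.ofLp) i + ε n i ω)
    -- the design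
    (C : Matrix (Fin p) (Fin p) ℝ) (hC : C.PosDef)
    (hXC : Tendsto (fun n : ℕ => (1 / (n : ℝ)) • ((X n)ᵀ * X n)) atTop (𝓝 C))
    (hXmax : Tendsto (fun n : ℕ => (1 / (n : ℝ)) * ⨆ i : Fin n, ∑ j, (X n i j) ^ 2)
      atTop (𝓝 0))
    -- the `√m`-consistent initial estimator
    (m : ℕ → ℕ) (βinit : ℕ → Ω → EuclideanSpace ℝ (Fin p))
    (hβinit_meas : ∀ n, AEMeasurable (βinit n) P)
    (hβinit : IsRootConsistent P m βinit βstar)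
    -- the tuning parameters
    (γ : ℝ) (hγ : 0 < γ) (lam : ℕ → ℝ) (hlam : ∀ n, 0 ≤ lam n)
    (hlam_zero : Tendsto (fun n : ℕ => lam n / √(n : ℝ)) atTop (𝓝 0))
    (hlam_top : Tendsto (fun n : ℕ => lam n * √((m n : ℝ) ^ γ / (n : ℝ))) atTop atTop)
    -- the Adaptive Lasso estimator
    (βhat : ℕ → Ω → EuclideanSpace ℝ (Fin p))
    (hβhat_meas : ∀ n, AEMeasurable (βhat n) P)
    (hβhat : ∀ n, ∀ᵐ ω ∂P, IsAdaptiveLasso (X n) (y n ω) (lam n) γ (βinit n ω) (βhat n ω)) :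
    Tendsto (fun n => P {ω | activeSet (βhat n ω) = activeSet βstar}) atTop (𝓝 1) ∧
    IsRootConsistent P (fun n => n) βhat βstar ∧
    TendstoInDistribution
      (fun (n : ℕ) ω => √(n : ℝ) • (subvector (activeSet βstar) (βhat n ω) -
        subvector (activeSet βstar) βstar))
      atTop (id : EuclideanSpace ℝ (activeSet βstar) → EuclideanSpace ℝ (activeSet βstar))
      (fun _ => P)
      (multivariateGaussian 0
        ((σ : ℝ) ^ 2 • (C.submatrix (fun i : activeSet βstar => (i : Fin p))
          (fun j : activeSet βstar => (j : Fin p)))⁻¹)) :=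
  mainTheorem11_general P X βstar σ ε y hy C hC hXC
    (by simpa only [NNReal.coe_pow] using
      tendstoInDistribution_noiseScore hε_law hε_indep hC.posSemidef hXC) m βinit hβinit γ hγ lam
    hlam_zero hlam_top βhat hβhat_meas hβhat
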